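/- Let $G$ be a finite simple graph that is $(P_7, C_7, C_4, \text{diamond})$-free, that is, no induced subgraph of $G$ is isomorphic to the path $P_7$ on seven vertices, the cycle $C_7$ on seven vertices, the cycle $C_4$ on four vertices, or the diamond (the complete graph on four vertices minus one edge). Then $\chi(G) \le \omega(G) + 1$, where $\chi(G)$ is the chromatic number and $\omega(G)$ is the maximum size of a clique of $G$. -/

import Mathlib

/-- The diamond: the complete graph on four vertices with one edge removed. -/
def diamondGraph : SimpleGraph (Fin 4) :=
  (⊤ : SimpleGraph (Fin 4)).deleteEdges {s(0, 1)}

/-- `G` is `H`-free: no induced subgraph of `G` is isomorphic to `H`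
(`SimpleGraph.IsIndContained H G` says that there is a graph embedding `H ↪g G`). -/
def IsInducedFree {U V : Type*} (H : SimpleGraph U) (G : SimpleGraph V) : Prop :=
  ¬ SimpleGraph.IsIndContained H G

/-! Put k = ω + 1; an edgeless graph is trivial, so k ≥ 3. By induction on the number of vertices, a
vertex of degree below k can be deleted and a disconnected graph split, so only connected graphs of
minimum degree at least k remain (`IsCritical`). Excluding C₄ and the diamond means that distinct
nonadjacent vertices have at most one common neighbour and that an edge with its common neighbours
is a clique. Hence for each edge vu, at least two neighbours of v lie outside N[u], and induced
paths can be prolonged.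

Suppose there is no induced C₅. Then there is no induced C₆ (`IsCritical.not_isHexagon`), and a
prolonged path ends as an induced P₇ or C₇ (`IsCritical.false_of_hexagonFree`).

Otherwise fix an induced C₅. It dominates the graph (`IsPentagon.reached`), and each vertex off it
has exactly one neighbour on it (`IsPentagon.attached`). If k ≥ 4, edges inside and between two
attachment classes form an induced P₇ (`IsPentagon.false_of_exists_fourth`). If k = 3, the graph is
triangle-free and the classes give an explicit 3-colouring. -/

namespace SimpleGraph

/-! ### Forbidden induced subgraphs in elementwise form. -/

variable {V : Type*} {G : SimpleGraph V}

/-- Elementwise form of being `(P₇, C₇, C₄, diamond)`-free. -/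
structure IsSparse (G : SimpleGraph V) : Prop where
  quad : ∀ x y a b, G.Adj x a → G.Adj x b → G.Adj y a → G.Adj y b → x ≠ y → a ≠ b → G.Adj a b
  path : ∀ a b c d e f g, G.Adj a b → G.Adj b c → G.Adj c d → G.Adj d e → G.Adj e f → G.Adj f g →
    ¬ G.Adj a c → ¬ G.Adj a d → ¬ G.Adj a e → ¬ G.Adj a f → ¬ G.Adj a g →
    ¬ G.Adj b d → ¬ G.Adj b e → ¬ G.Adj b f → ¬ G.Adj b g →
    ¬ G.Adj c e → ¬ G.Adj c f → ¬ G.Adj c g → ¬ G.Adj d f → ¬ G.Adj d g → ¬ G.Adj e g → False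
  cycle : ∀ a b c d e f g, G.Adj a b → G.Adj b c → G.Adj c d → G.Adj d e → G.Adj e f → G.Adj f g →
    ¬ G.Adj a c → ¬ G.Adj a d → ¬ G.Adj a e → ¬ G.Adj a f → G.Adj a g →
    ¬ G.Adj b d → ¬ G.Adj b e → ¬ G.Adj b f → ¬ G.Adj b g →
    ¬ G.Adj c e → ¬ G.Adj c f → ¬ G.Adj c g → ¬ G.Adj d f → ¬ G.Adj d g → ¬ G.Adj e g → False

theorem isIndContained_of_adj_iff {n : ℕ} {H : SimpleGraph (Fin n)} (f : Fin n → V)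
    (hf : Function.Injective f) (h : ∀ i j, i < j → (G.Adj (f i) (f j) ↔ H.Adj i j)) :
    H.IsIndContained G := by
  refine ⟨⟨⟨f, hf⟩, fun {i j} => ?_⟩⟩
  rcases lt_trichotomy i j with hij | rfl | hij
  · exact h i j hij
  · simp
  · simpa [G.adj_comm, H.adj_comm] using h j i hij

/-- If no two vertices of `H` share a neighbourhood, injectivity is automatic. This applies to P₇
and C₇, so `path` and `cycle` need no distinctness hypotheses; C₄ and the diamond have twins. -/
theorem isIndContained_of_twinFree {n : ℕ} {H : SimpleGraph (Fin n)}
    (hH : ∀ i j, (∀ l, H.Adj i l ↔ H.Adj j l) → i = j) (f : Fin n → V)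
    (h : ∀ i j, i < j → (G.Adj (f i) (f j) ↔ H.Adj i j)) :
    H.IsIndContained G := by
  refine isIndContained_of_adj_iff f (fun i j hij => hH i j fun l => ?_) h
  have key : ∀ i j, G.Adj (f i) (f j) ↔ H.Adj i j := by
    intro i j
    rcases lt_trichotomy i j with hij | rfl | hij
    · exact h i j hij
    · simp
    · simpa [G.adj_comm, H.adj_comm] using h j i hij
  rw [← key, ← key, hij]

theorem isSparse_of_free (hP7 : IsInducedFree (pathGraph 7) G) (hC7 : IsInducedFree (cycleGraph 7) G)
    (hC4 : IsInducedFree (cycleGraph 4) G) (hD : IsInducedFree diamondGraph G) : G.IsSparse where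
  quad := by
    intro x y a b h1 h2 h3 h4 hxy hab
    by_contra h
    have := h1.ne; have := h2.ne; have := h3.ne; have := h4.ne
    by_cases hx : G.Adj x y
    · refine hD (isIndContained_of_adj_iff ![a, b, x, y] ?_ ?_)
      · intro i j hij
        fin_cases i <;> fin_cases j <;> simp_all
      · intro i j hij
        fin_cases i <;> fin_cases j <;> simp_all [diamondGraph, G.adj_comm]
    · refine hC4 (isIndContained_of_adj_iff ![a, x, b, y] ?_ ?_)
      · intro i j hij
        fin_cases i <;> fin_cases j <;> simp_all
      · intro i j hij
        fin_cases i <;> fin_cases j <;> simp_all [cycleGraph_adj, G.adj_comm] <;> decide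
  path := by
    intro a b c d e f g
    intros
    refine hP7 (isIndContained_of_twinFree ?_ ![a, b, c, d, e, f, g] ?_)
    · simp only [pathGraph_adj]; decide
    · intro i j hij
      fin_cases i <;> fin_cases j <;> simp_all [pathGraph_adj]
  cycle := by
    intro a b c d e f g
    intros
    refine hC7 (isIndContained_of_twinFree ?_ ![a, b, c, d, e, f, g] ?_)
    · simp only [cycleGraph_adj]; decide
    · intro i j hij
      fin_cases i <;> fin_cases j <;> simp_all [cycleGraph_adj] <;> decide

theorem IsSparse.induce (h : G.IsSparse) (s : Set V) : (G.induce s).IsSparse where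
  quad x y a b h1 h2 h3 h4 hxy hab :=
    h.quad x y a b h1 h2 h3 h4 (fun e => hxy (Subtype.ext e)) (fun e => hab (Subtype.ext e))
  path a b c d e f g := h.path a b c d e f g
  cycle a b c d e f g := h.cycle a b c d e f g

end SimpleGraph

/-! ### Critical graphs without an induced pentagon. -/

namespace SimpleGraph

variable {V : Type*} {G : SimpleGraph V}

theorem IsSparse.eq_of_common (hG : G.IsSparse) {x y u v : V} (hxy : x ≠ y) (hn : ¬ G.Adj x y)
    (h1 : G.Adj u x) (h2 : G.Adj u y) (h3 : G.Adj v x) (h4 : G.Adj v y) : u = v := by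
  by_contra hne
  exact hn (hG.quad u v x y h1 h2 h3 h4 hne hxy)

/-- A path on three edges with a missing chord does not close up to a quadrilateral. -/
theorem IsSparse.not_adj_of_path (hG : G.IsSparse) {x y z w : V} (h1 : G.Adj x y) (h2 : G.Adj y z)
    (h3 : G.Adj z w) (hxz : ¬ G.Adj x z) (hne : x ≠ z) (hyw : y ≠ w) : ¬ G.Adj x w :=
  fun h => hyw (hG.eq_of_common hne hxz h1.symm h2 h.symm h3.symm)

/-- The properties of a connected sparse graph that resists colouring: the minimum degree is at least
three, or four if there are triangles, and for each edge `v u` at least two neighbours of `v` are not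
adjacent to `u`. -/
structure IsCritical (G : SimpleGraph V) : Prop extends G.IsSparse where
  exists_third : ∀ v p q, ∃ z, G.Adj v z ∧ z ≠ p ∧ z ≠ q
  exists_pair : ∀ v u, G.Adj v u → ∃ x y, x ≠ y ∧ G.Adj v x ∧ G.Adj v y ∧ x ≠ u ∧ y ≠ u ∧
    ¬ G.Adj x u ∧ ¬ G.Adj y u
  exists_fourth_or : (∀ v p q r, ∃ z, G.Adj v z ∧ z ≠ p ∧ z ≠ q ∧ z ≠ r) ∨
    ∀ x y z, G.Adj x y → G.Adj y z → ¬ G.Adj x z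
  mem_of_closed : ∀ s : Set V, s.Nonempty → (∀ x ∈ s, ∀ y, G.Adj x y → y ∈ s) → ∀ x, x ∈ s

/-- Prolongs an induced path backwards by one vertex. -/
theorem IsCritical.exists_extend (hG : G.IsCritical) {v u : V} (h : G.Adj v u) :
    ∃ x, G.Adj x v ∧ x ≠ u ∧ ¬ G.Adj x u := by
  obtain ⟨x, -, -, h1, -, h2, -, h3, -⟩ := hG.exists_pair v u h
  exact ⟨x, h1.symm, h2, h3⟩

/-- `a b c d e` is an induced cycle of length five. -/
structure IsPentagon (G : SimpleGraph V) (a b c d e : V) : Prop where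
  ab : G.Adj a b
  bc : G.Adj b c
  cd : G.Adj c d
  de : G.Adj d e
  ea : G.Adj e a
  ac : ¬ G.Adj a c
  bd : ¬ G.Adj b d
  ce : ¬ G.Adj c e
  da : ¬ G.Adj d a
  eb : ¬ G.Adj e b

theorem IsPentagon.rotate {a b c d e : V} (h : G.IsPentagon a b c d e) :
    G.IsPentagon b c d e a :=
  ⟨h.bc, h.cd, h.de, h.ea, h.ab, h.bd, h.ce, h.da, h.eb, h.ac⟩

theorem IsPentagon.reflect {a b c d e : V} (h : G.IsPentagon a b c d e) :
    G.IsPentagon a e d c b :=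
  ⟨h.ea.symm, h.de.symm, h.cd.symm, h.bc.symm, h.ab.symm, fun t => h.da t.symm,
    fun t => h.ce t.symm, fun t => h.bd t.symm, fun t => h.ac t.symm, fun t => h.eb t.symm⟩

/-- `G` has no induced cycle of length five. -/
def PentagonFree (G : SimpleGraph V) : Prop := ∀ a b c d e, ¬ G.IsPentagon a b c d e

theorem PentagonFree.not_adj (hG : G.PentagonFree) {a b c d e : V} (ab : G.Adj a b)
    (bc : G.Adj b c) (cd : G.Adj c d) (de : G.Adj d e) (ac : ¬ G.Adj a c) (bd : ¬ G.Adj b d)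
    (ce : ¬ G.Adj c e) (ad : ¬ G.Adj a d) (be : ¬ G.Adj b e) : ¬ G.Adj a e :=
  fun h => hG a b c d e ⟨ab, bc, cd, de, h.symm, ac, bd, ce, fun t => ad t.symm, fun t => be t.symm⟩

/-- `a b c d e f` is an induced cycle of length six. -/
structure IsHexagon (G : SimpleGraph V) (a b c d e f : V) : Prop where
  ab : G.Adj a b
  bc : G.Adj b c
  cd : G.Adj c d
  de : G.Adj d e
  ef : G.Adj e f
  fa : G.Adj f a
  ac : ¬ G.Adj a c
  ad : ¬ G.Adj a d
  ae : ¬ G.Adj a e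
  bd : ¬ G.Adj b d
  be : ¬ G.Adj b e
  bf : ¬ G.Adj b f
  ce : ¬ G.Adj c e
  cf : ¬ G.Adj c f
  df : ¬ G.Adj d f

theorem IsHexagon.reflect {a b c d e f : V} (h : G.IsHexagon a b c d e f) :
    G.IsHexagon a f e d c b := by
  obtain ⟨ab, bc, cd, de, ef, fa, ac, ad, ae, bd, be, bf, ce, cf, df⟩ := h
  constructor <;> first | assumption | rwa [G.adj_comm]

/-- Without induced cycles of length five or six, an induced path can be prolonged to one on seven
vertices. -/
theorem IsCritical.false_of_hexagonFree (hG : G.IsCritical) (h5 : G.PentagonFree)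
    (h6 : ∀ a b c d e f, ¬ G.IsHexagon a b c d e f) (a b : V) (hab : G.Adj a b) : False := by
  obtain ⟨p, pa, pb, npb⟩ := hG.exists_extend hab
  obtain ⟨q, qp, qa, nqa⟩ := hG.exists_extend pa
  have nqb := hG.not_adj_of_path qp pa hab nqa qa pb
  obtain ⟨r, rq, rp, nrp⟩ := hG.exists_extend qp
  have nra := hG.not_adj_of_path rq qp pa nrp rp qa
  have nrb := h5.not_adj rq qp pa hab nrp nqa npb nra nqb
  obtain ⟨s, sr, sq, nsq⟩ := hG.exists_extend rq
  have nsp := hG.not_adj_of_path sr rq qp nsq sq rp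
  have nsa := h5.not_adj sr rq qp pa nsq nrp nqa nsp nra
  have nsb : ¬ G.Adj s b := fun h => h6 s r q p a b
    ⟨sr, rq, qp, pa, hab, h.symm, nsq, nsp, nsa, nrp, nra, nrb, nqa, nqb, npb⟩
  obtain ⟨t, ts, tr, ntr⟩ := hG.exists_extend sr
  have ntq := hG.not_adj_of_path ts sr rq ntr tr sq
  have ntp := h5.not_adj ts sr rq qp ntr nsq nrp ntq nsp
  have nta : ¬ G.Adj t a := fun h => h6 t s r q p a
    ⟨ts, sr, rq, qp, pa, h.symm, ntr, ntq, ntp, nsq, nsp, nsa, nrp, nra, nqa⟩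
  -- All other chords are excluded, so only the two ends decide between C₇ and P₇.
  by_cases h : G.Adj t b
  · exact hG.cycle t s r q p a b ts sr rq qp pa hab ntr ntq ntp nta h nsq nsp nsa nsb
      nrp nra nrb nqa nqb npb
  · exact hG.path t s r q p a b ts sr rq qp pa hab ntr ntq ntp nta h nsq nsp nsa nsb
      nrp nra nrb nqa nqb npb

/-- A vertex attached to an induced hexagon has one neighbour on it, or two consecutive ones. -/
theorem IsHexagon.not_adj (hG : G.IsSparse) (h5 : G.PentagonFree) {a b c d e f z : V}
    (h : G.IsHexagon a b c d e f) (za : G.Adj z a) (hzb : z ≠ b) (hzf : z ≠ f) :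
    ¬ G.Adj z c ∧ ¬ G.Adj z d ∧ ¬ G.Adj z e ∧ ¬ (G.Adj z b ∧ G.Adj z f) := by
  obtain ⟨ab, bc, cd, de, ef, fa, ac, ad, ae, bd, be, bf, ce, cf, df⟩ := h
  have zc : ¬ G.Adj z c := fun t =>
    hzb (hG.eq_of_common (by grind [G.adj_comm]) ac za t ab.symm bc)
  have ze : ¬ G.Adj z e := fun t =>
    hzf (hG.eq_of_common (by grind [G.adj_comm]) ae za t fa ef.symm)
  have zbf : ¬ (G.Adj z b ∧ G.Adj z f) := fun t =>
    za.ne (hG.eq_of_common (by grind [G.adj_comm]) bf t.1 t.2 ab fa.symm)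
  refine ⟨zc, fun t => ?_, ze, zbf⟩
  by_cases zb : G.Adj z b
  · refine h5.not_adj za fa.symm ef.symm de.symm (fun s => zbf ⟨zb, s⟩) ae ?_ ze ad t
    grind [G.adj_comm]
  · exact h5.not_adj za ab bc cd zb ac bd zc ad t

/-- If z formed a triangle on the edge ab, a neighbour x of z outside N[a] would start the induced
path x z b c d e f. -/
theorem IsCritical.not_adj_of_hexagon (hG : G.IsCritical) (h5 : G.PentagonFree)
    {a b c d e f z : V} (h : G.IsHexagon a b c d e f) (za : G.Adj z a) (hzb : z ≠ b) (hzf : z ≠ f) :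
    ¬ G.Adj z b := by
  intro zb
  obtain ⟨zc, zd, ze, zbf⟩ := h.not_adj hG.toIsSparse h5 za hzb hzf
  obtain ⟨ab, bc, cd, de, ef, fa, ac, ad, ae, bd, be, bf, ce, cf, df⟩ := h
  have zf : ¬ G.Adj z f := fun t => zbf ⟨zb, t⟩
  obtain ⟨x, xz, hxa, xa⟩ := hG.exists_extend za
  have xb : ¬ G.Adj x b := fun t => xa (hG.quad z b x a xz.symm za t.symm ab.symm hzb hxa)
  have xf : ¬ G.Adj x f := hG.not_adj_of_path xz za fa.symm xa hxa hzf
  have xc : ¬ G.Adj x c := hG.not_adj_of_path xz zb bc xb (by grind [G.adj_comm])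
    (by grind [G.adj_comm])
  have xd : ¬ G.Adj x d := h5.not_adj xz zb bc cd xb zc bd xc zd
  have xe : ¬ G.Adj x e := h5.not_adj xz za fa.symm ef.symm xa zf ae xf ze
  exact hG.path x z b c d e f xz zb bc cd de ef xb xc xd xe xf zc zd ze zf bd be bf ce cf df

/-- A third neighbour z of a has no other neighbour on the hexagon. By P₇-freeness the neighbours of
z outside N[a] all see d; there are at least two, yet z and d have at most one common neighbour. -/
theorem IsCritical.not_isHexagon (hG : G.IsCritical) (h5 : G.PentagonFree)
    (a b c d e f : V) : ¬ G.IsHexagon a b c d e f := by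
  intro h
  obtain ⟨z, az, hzb, hzf⟩ := hG.exists_third a b f
  have za := az.symm
  obtain ⟨zc, zd, ze, -⟩ := h.not_adj hG.toIsSparse h5 za hzb hzf
  have zb := hG.not_adj_of_hexagon h5 h za hzb hzf
  have zf := hG.not_adj_of_hexagon h5 h.reflect za hzf hzb
  obtain ⟨ab, bc, cd, de, ef, fa, ac, ad, ae, bd, be, bf, ce, cf, df⟩ := h
  have key : ∀ x, G.Adj z x → x ≠ a → ¬ G.Adj x a → G.Adj x d := by
    intro x zx hxa xa
    by_contra xd
    have xb := hG.not_adj_of_path zx.symm za ab xa hxa hzb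
    have xf := hG.not_adj_of_path zx.symm za fa.symm xa hxa hzf
    have xc := h5.not_adj zx.symm za ab bc xa zb ac xb zc
    have xe := h5.not_adj zx.symm za fa.symm ef.symm xa zf ae xf ze
    exact hG.path x z a b c d e zx.symm za ab bc cd de xa xb xc xd xe zb zc zd ze ac ad ae bd be ce
  obtain ⟨x, y, hxy, zx, zy, hxa, hya, xa, ya⟩ := hG.exists_pair z a za
  exact hxy (hG.eq_of_common (by grind) zd zx.symm (key x zx hxa xa) zy.symm
    (key y zy hya ya))

end SimpleGraph

/-! ### An induced pentagon dominates a critical graph. -/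

namespace SimpleGraph

variable {V : Type*} {G : SimpleGraph V} {a b c d e : V}

/-- `x` has a neighbour among `a b c d e`. -/
def Reached (G : SimpleGraph V) (a b c d e x : V) : Prop :=
  G.Adj x a ∨ G.Adj x b ∨ G.Adj x c ∨ G.Adj x d ∨ G.Adj x e

theorem Reached.rotate {x : V} (h : G.Reached a b c d e x) : G.Reached b c d e a x := by
  unfold Reached at *; tauto

theorem not_reached_rotate {x : V} (h : ¬ G.Reached a b c d e x) : ¬ G.Reached b c d e a x :=
  fun t => h t.rotate.rotate.rotate.rotate

theorem IsPentagon.not_adj (h : G.IsPentagon a b c d e) (hG : G.IsSparse) {z : V}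
    (za : G.Adj z a) (hzb : z ≠ b) (hze : z ≠ e) :
    ¬ G.Adj z c ∧ ¬ G.Adj z d ∧ ¬ (G.Adj z b ∧ G.Adj z e) := by
  obtain ⟨ab, bc, cd, de, ea, ac, bd, ce, da, eb⟩ := h
  refine ⟨fun t => hzb ?_, fun t => hze ?_, fun t => za.ne ?_⟩
  · exact hG.eq_of_common (by grind [G.adj_comm]) ac za t ab.symm bc
  · exact hG.eq_of_common (by grind [G.adj_comm]) da t za de.symm ea
  · exact hG.eq_of_common (by grind [G.adj_comm]) eb t.2 t.1 ea.symm ab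

/-- Otherwise y x p continues along the pentagon to an induced P₇. The three cases choose where to
enter it, according to a second neighbour of p at b or e. -/
theorem IsPentagon.adj_of_far_of_adj (h : G.IsPentagon a b c d e) (hG : G.IsSparse) {x y p : V}
    (hx : ¬ G.Reached a b c d e x) (hy : ¬ G.Reached a b c d e y) (xy : G.Adj x y)
    (px : G.Adj p x) (pa : G.Adj p a) : G.Adj p y := by
  simp only [Reached, not_or] at hx hy
  obtain ⟨xa, xb, xc, xd, xe⟩ := hx
  obtain ⟨ya, yb, yc, yd, ye⟩ := hy
  obtain ⟨pc, pd, pbe⟩ := h.not_adj hG pa (by grind [G.adj_comm]) (by grind [G.adj_comm])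
  obtain ⟨ab, bc, cd, de, ea, ac, bd, ce, da, eb⟩ := h
  by_contra py
  have yp : ¬ G.Adj y p := fun t => py t.symm
  have ec : ¬ G.Adj e c := fun t => ce t.symm
  have db : ¬ G.Adj d b := fun t => bd t.symm
  have be : ¬ G.Adj b e := fun t => eb t.symm
  have ad : ¬ G.Adj a d := fun t => da t.symm
  by_cases pb : G.Adj p b
  · exact hG.path y x p b c d e xy.symm px.symm pb bc cd de yp yb yc yd ye xb xc xd xe
      pc pd (fun t => pbe ⟨pb, t⟩) bd be ce
  by_cases pe : G.Adj p e
  · exact hG.path y x p e d c b xy.symm px.symm pe de.symm cd.symm bc.symm yp ye yd yc yb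
      xe xd xc xb pd pc pb ec eb db
  · exact hG.path y x p a b c d xy.symm px.symm pa ab bc cd yp ya yb yc yd
      xa xb xc xd pb pc pd ac ad bd

theorem IsPentagon.adj_of_far (h : G.IsPentagon a b c d e) (hG : G.IsSparse) {x y p : V}
    (hx : ¬ G.Reached a b c d e x) (hy : ¬ G.Reached a b c d e y) (xy : G.Adj x y)
    (px : G.Adj p x) (hp : G.Reached a b c d e p) : G.Adj p y := by
  have r {a b c d e x : V} := not_reached_rotate (G := G) (a := a) (b := b) (c := c) (d := d)
    (e := e) (x := x)
  rcases hp with t | t | t | t | t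
  · exact h.adj_of_far_of_adj hG hx hy xy px t
  · exact h.rotate.adj_of_far_of_adj hG (r hx) (r hy) xy px t
  · exact h.rotate.rotate.adj_of_far_of_adj hG (r (r hx)) (r (r hy)) xy px t
  · exact h.rotate.rotate.rotate.adj_of_far_of_adj hG (r (r (r hx))) (r (r (r hy))) xy px t
  · exact h.rotate.rotate.rotate.rotate.adj_of_far_of_adj hG (r (r (r (r hx)))) (r (r (r (r hy))))
      xy px t

/-- If y were unreached, a neighbour z of x outside N[y] would be unreached too. Then p sees both y
and z, and the common neighbours y, z of x and p would be adjacent. -/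
theorem IsPentagon.reached_of_adj_far (h : G.IsPentagon a b c d e) (hG : G.IsCritical) {x y p : V}
    (hx : ¬ G.Reached a b c d e x) (px : G.Adj p x) (hp : G.Reached a b c d e p)
    (xy : G.Adj x y) : G.Reached a b c d e y := by
  by_contra hy
  have py := h.adj_of_far hG.toIsSparse hx hy xy px hp
  obtain ⟨z, zx, hzy, zy⟩ := hG.exists_extend xy
  have hz : ¬ G.Reached a b c d e z := fun t => zy (h.adj_of_far hG.toIsSparse hx hy xy zx t)
  have pz := h.adj_of_far hG.toIsSparse hx hz zx.symm px hp
  exact zy (hG.quad x p z y zx.symm xy pz py px.ne' hzy)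

/-- Two neighbours of a vertex at distance two from the pentagon cannot each have just one
neighbour on it if these are consecutive. -/
theorem IsPentagon.adj_or_adj_of_far (h : G.IsPentagon a b c d e) (hG : G.IsSparse) {x p q : V}
    (hx : ¬ G.Reached a b c d e x) (px : G.Adj p x) (qx : G.Adj q x) (hpq : p ≠ q)
    (pa : G.Adj p a) (qb : G.Adj q b) : G.Adj p e ∨ G.Adj q c := by
  simp only [Reached, not_or] at hx
  obtain ⟨xa, xb, xc, xd, xe⟩ := hx
  by_contra! hn
  obtain ⟨pe, qc⟩ := hn
  obtain ⟨pc, pd, -⟩ := h.not_adj hG pa (by grind [G.adj_comm]) (by grind [G.adj_comm])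
  obtain ⟨qd, qe, -⟩ := h.rotate.not_adj hG qb (by grind [G.adj_comm]) (by grind [G.adj_comm])
  obtain ⟨ab, bc, cd, de, ea, ac, bd, ce, da, eb⟩ := h
  have hxa : x ≠ a := by grind [G.adj_comm]
  have hxb : x ≠ b := by grind [G.adj_comm]
  have qa : ¬ G.Adj q a := fun t => hpq (hG.eq_of_common hxa xa px pa qx t)
  have pb : ¬ G.Adj p b := fun t => hpq (hG.eq_of_common hxb xb px t qx qb)
  have pq : ¬ G.Adj p q := hG.not_adj_of_path pa ab qb.symm pb (by grind [G.adj_comm])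
    (by grind [G.adj_comm])
  exact hG.path q x p a e d c qx px.symm pa ea.symm de.symm cd.symm (fun t => pq t.symm) qa qe qd qc
    xa xe xd xc pe pd pc (fun t => da t.symm) ac (fun t => ce t.symm)

/-- A vertex at distance two from the pentagon does not have three neighbours with one neighbour
each on the pentagon. -/
theorem IsPentagon.false_of_far_of_three (h : G.IsPentagon a b c d e) (hG : G.IsSparse)
    {x p q r : V} (hx : ¬ G.Reached a b c d e x) (px : G.Adj p x) (qx : G.Adj q x)
    (rx : G.Adj r x) (hpq : p ≠ q) (hpr : p ≠ r) (hqr : q ≠ r)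
    (hp : G.Adj p a ∧ ¬ G.Adj p b ∧ ¬ G.Adj p e)
    (hq : G.Reached a b c d e q) (hr : G.Reached a b c d e r)
    (h1 : ∀ t, G.Adj t x → ¬ (G.Adj t a ∧ G.Adj t b) ∧ ¬ (G.Adj t b ∧ G.Adj t c) ∧
      ¬ (G.Adj t c ∧ G.Adj t d) ∧ ¬ (G.Adj t d ∧ G.Adj t e) ∧ ¬ (G.Adj t e ∧ G.Adj t a)) :
    False := by
  -- A second neighbour of x cannot see a, and seeing only b or only e is excluded by
  -- `adj_or_adj_of_far`.
  have key : ∀ s, G.Adj s x → p ≠ s → G.Reached a b c d e s → G.Adj s c ∨ G.Adj s d := by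
    intro s sx hps hs
    have hxa : ¬ G.Adj x a ∧ x ≠ a := by
      have := h.ab; have := h.bc
      unfold Reached at hx; grind [G.adj_comm]
    rcases hs with t | t | t | t | t
    · exact (hps (hG.eq_of_common hxa.2 hxa.1 px hp.1 sx t)).elim
    · rcases h.adj_or_adj_of_far hG hx px sx hps hp.1 t with u | u
      · exact (hp.2.2 u).elim
      · exact .inl u
    · exact .inl t
    · exact .inr t
    · rcases h.rotate.rotate.rotate.rotate.adj_or_adj_of_far hG
        (not_reached_rotate (not_reached_rotate (not_reached_rotate
          (not_reached_rotate hx)))) sx px hps.symm t hp.1 with u | u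
      · exact .inr u
      · exact (hp.2.1 u).elim
  have hc : ¬ G.Adj x c ∧ x ≠ c := by
    have := h.bc
    unfold Reached at hx; grind [G.adj_comm]
  have hd : ¬ G.Adj x d ∧ x ≠ d := by
    have := h.cd
    unfold Reached at hx; grind [G.adj_comm]
  have key' : ∀ s t, G.Adj s x → G.Adj t x → s ≠ t → G.Adj s c → G.Adj t d → False := by
    intro s t sx tx hst sc td
    rcases h.rotate.rotate.adj_or_adj_of_far hG
      (not_reached_rotate (not_reached_rotate hx)) sx tx hst sc td with u | u
    · exact (h1 s sx).2.1 ⟨u, sc⟩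
    · exact (h1 t tx).2.2.2.1 ⟨td, u⟩
  rcases key q qx hpq hq with u | u <;> rcases key r rx hpr hr with v | v
  · exact hqr (hG.eq_of_common hc.2 hc.1 qx u rx v)
  · exact key' q r qx rx hqr u v
  · exact key' r q rx qx hqr.symm v u
  · exact hqr (hG.eq_of_common hd.2 hd.1 qx u rx v)

/-- A vertex at distance two from the pentagon that has a neighbour with two neighbours on the
pentagon has at most three neighbours. -/
theorem IsPentagon.false_of_far_of_four (h : G.IsPentagon a b c d e) (hG : G.IsSparse)
    {x p q r s : V} (hx : ¬ G.Reached a b c d e x) (px : G.Adj p x) (qx : G.Adj q x)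
    (rx : G.Adj r x) (sx : G.Adj s x) (hpq : p ≠ q) (hpr : p ≠ r) (hps : p ≠ s) (hqr : q ≠ r)
    (hqs : q ≠ s) (hrs : r ≠ s) (pa : G.Adj p a) (pb : G.Adj p b)
    (hq : G.Reached a b c d e q) (hr : G.Reached a b c d e r) (hs : G.Reached a b c d e s) :
    False := by
  have hne : ∀ v, G.Adj v a ∨ G.Adj v b ∨ G.Adj v c ∨ G.Adj v d ∨ G.Adj v e → x ≠ v := by
    rintro v hv rfl; exact hx hv
  have ha := hne a (.inr (.inl h.ab))
  have hb := hne b (.inr (.inr (.inl h.bc)))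
  have hc := hne c (.inr (.inl h.bc.symm))
  have hd := hne d (.inr (.inr (.inl h.cd.symm)))
  have he := hne e (.inl h.ea)
  have hx' := hx
  simp only [Reached, not_or] at hx'
  obtain ⟨xa, xb, xc, xd, xe⟩ := hx'
  have u : ∀ v, x ≠ v → ¬ G.Adj x v → ∀ p q, G.Adj p x → G.Adj q x → p ≠ q →
      ¬ (G.Adj p v ∧ G.Adj q v) :=
    fun v h1 h2 p q hp hq hn t => hn (hG.eq_of_common h1 h2 hp t.1 hq t.2)
  -- Each pentagon vertex has at most one neighbour in N(x), and p occupies a and b, so the other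
  -- three take c, d, e bijectively. The pair at c, d then forces a second neighbour at b or e.
  have key : ∀ q r s, G.Adj q x → G.Adj r x → G.Adj s x → p ≠ q → q ≠ r → r ≠ s →
      G.Adj q c → G.Adj r d → G.Adj s e → False := by
    intro q r s qx rx sx hpq hqr hrs qc rd se
    rcases h.rotate.rotate.adj_or_adj_of_far hG
      (not_reached_rotate (not_reached_rotate hx)) qx rx hqr qc rd with t | t
    · exact u b hb xb p q px qx hpq ⟨pb, t⟩
    · exact u e he xe r s rx sx hrs ⟨t, se⟩
  have key' : ∀ q, G.Adj q x → p ≠ q → G.Reached a b c d e q →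
      G.Adj q c ∨ G.Adj q d ∨ G.Adj q e := by
    intro q qx hpq hq
    rcases hq with t | t | t
    · exact (u a ha xa p q px qx hpq ⟨pa, t⟩).elim
    · exact (u b hb xb p q px qx hpq ⟨pb, t⟩).elim
    · exact t
  have uc := u c hc xc
  have ud := u d hd xd
  have ue := u e he xe
  rcases key' q qx hpq hq with tq | tq | tq <;> rcases key' r rx hpr hr with tr | tr | tr <;>
    rcases key' s sx hps hs with ts | ts | ts
  all_goals first
    | exact uc q r qx rx hqr ⟨tq, tr⟩
    | exact ud q r qx rx hqr ⟨tq, tr⟩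
    | exact ue q r qx rx hqr ⟨tq, tr⟩
    | exact uc q s qx sx hqs ⟨tq, ts⟩
    | exact ud q s qx sx hqs ⟨tq, ts⟩
    | exact ue q s qx sx hqs ⟨tq, ts⟩
    | exact uc r s rx sx hrs ⟨tr, ts⟩
    | exact ud r s rx sx hrs ⟨tr, ts⟩
    | exact ue r s rx sx hrs ⟨tr, ts⟩
    | exact key q r s qx rx sx hpq hqr hrs tq tr ts
    | exact key q s r qx sx rx hpq hqs hrs.symm tq ts tr
    | exact key r q s rx qx sx hpr hqr.symm hqs tr tq ts
    | exact key r s q rx sx qx hpr hrs hqs.symm tr ts tq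
    | exact key s q r sx qx rx hps hqs.symm hqr ts tq tr
    | exact key s r q sx rx qx hps hrs.symm hqr.symm ts tr tq

theorem IsPentagon.not_adj_two_of_far (h : G.IsPentagon a b c d e) (hG : G.IsCritical) {x : V}
    (hx : ¬ G.Reached a b c d e x) (hN : ∀ y, G.Adj x y → G.Reached a b c d e y) (p : V)
    (px : G.Adj p x) : ¬ (G.Adj p a ∧ G.Adj p b) := by
  rintro ⟨pa, pb⟩
  rcases hG.exists_fourth_or with h4 | h3
  · obtain ⟨q, xq, hqp, -, -⟩ := h4 x p p p
    obtain ⟨r, xr, hrp, hrq, -⟩ := h4 x p q q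
    obtain ⟨s, xs, hsp, hsq, hsr⟩ := h4 x p q r
    exact h.false_of_far_of_four hG.toIsSparse hx px xq.symm xr.symm xs.symm hqp.symm hrp.symm
      hsp.symm hrq.symm hsq.symm hsr.symm pa pb (hN q xq) (hN r xr) (hN s xs)
  · exact h3 p a b pa h.ab pb

theorem IsPentagon.false_of_far_of_adj (h : G.IsPentagon a b c d e) (hG : G.IsCritical) {x p : V}
    (hx : ¬ G.Reached a b c d e x) (hN : ∀ y, G.Adj x y → G.Reached a b c d e y)
    (px : G.Adj p x) (pa : G.Adj p a) : False := by
  have r {a b c d e x : V} := not_reached_rotate (G := G) (a := a) (b := b) (c := c) (d := d)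
    (e := e) (x := x)
  have n : ∀ {a b c d e : V}, (∀ y, G.Adj x y → G.Reached a b c d e y) →
      ∀ y, G.Adj x y → G.Reached b c d e a y := fun hn y hy => (hn y hy).rotate
  have t1 := h.not_adj_two_of_far hG hx hN
  have t2 := h.rotate.not_adj_two_of_far hG (r hx) (n hN)
  have t3 := h.rotate.rotate.not_adj_two_of_far hG (r (r hx)) (n (n hN))
  have t4 := h.rotate.rotate.rotate.not_adj_two_of_far hG (r (r (r hx))) (n (n (n hN)))
  have t5 := h.rotate.rotate.rotate.rotate.not_adj_two_of_far hG (r (r (r (r hx))))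
    (n (n (n (n hN))))
  obtain ⟨q, xq, hqp, -⟩ := hG.exists_third x p p
  obtain ⟨s, xs, hsp, hsq⟩ := hG.exists_third x p q
  exact h.false_of_far_of_three hG.toIsSparse hx px xq.symm xs.symm hqp.symm hsp.symm hsq.symm
    ⟨pa, fun t => t1 p px ⟨pa, t⟩, fun t => t5 p px ⟨t, pa⟩⟩ (hN q xq) (hN s xs)
    fun t tx => ⟨t1 t tx, t2 t tx, t3 t tx, t4 t tx, t5 t tx⟩

theorem IsPentagon.reached (h : G.IsPentagon a b c d e) (hG : G.IsCritical) (x : V) :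
    G.Reached a b c d e x := by
  refine hG.mem_of_closed {x | G.Reached a b c d e x} ⟨a, .inr (.inl h.ab)⟩ ?_ x
  intro p hp x px
  by_contra hx
  have r {a b c d e x : V} := not_reached_rotate (G := G) (a := a) (b := b) (c := c) (d := d)
    (e := e) (x := x)
  have n : ∀ {a b c d e : V}, (∀ y, G.Adj x y → G.Reached a b c d e y) →
      ∀ y, G.Adj x y → G.Reached b c d e a y := fun hn y hy => (hn y hy).rotate
  have hN : ∀ y, G.Adj x y → G.Reached a b c d e y := fun y =>
    h.reached_of_adj_far hG hx px hp
  rcases hp with t | t | t | t | t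
  · exact h.false_of_far_of_adj hG hx hN px t
  · exact h.rotate.false_of_far_of_adj hG (r hx) (n hN) px t
  · exact h.rotate.rotate.false_of_far_of_adj hG (r (r hx)) (n (n hN)) px t
  · exact h.rotate.rotate.rotate.false_of_far_of_adj hG (r (r (r hx))) (n (n (n hN))) px t
  · exact h.rotate.rotate.rotate.rotate.false_of_far_of_adj hG (r (r (r (r hx))))
      (n (n (n (n hN)))) px t

end SimpleGraph

/-! ### Attachment classes of the pentagon. -/

namespace SimpleGraph

variable {V : Type*} {G : SimpleGraph V} {a b c d e : V}

/-- If z saw both a and b, domination would force two neighbours of z outside N[a] to see d, but z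
and d have at most one common neighbour. -/
theorem IsPentagon.not_adj_next (h : G.IsPentagon a b c d e) (hG : G.IsCritical) {z : V}
    (za : G.Adj z a) (hzb : z ≠ b) (hze : z ≠ e) : ¬ G.Adj z b := by
  intro zb
  obtain ⟨zc, zd, zbe⟩ := h.not_adj hG.toIsSparse za hzb hze
  have hzc : z ≠ c := by rintro rfl; exact h.ac za.symm
  have hzd : z ≠ d := by rintro rfl; exact h.da za
  have key : ∀ x, G.Adj z x → x ≠ a → ¬ G.Adj x a → G.Adj x d := by
    intro x zx hxa xa
    have xb : ¬ G.Adj x b := fun t => xa (hG.quad z b x a zx za t.symm h.ab.symm hzb hxa)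
    have hxb : x ≠ b := by rintro rfl; exact xa h.ab.symm
    rcases h.reached hG x with t | t | t | t | t
    · exact (xa t).elim
    · exact (xb t).elim
    · exact (hG.not_adj_of_path zx.symm zb h.bc xb hxb hzc t).elim
    · exact t
    · exact (hG.not_adj_of_path zx.symm za h.ea.symm xa hxa hze t).elim
  obtain ⟨x, y, hxy, zx, zy, hxa, hya, xa, ya⟩ := hG.exists_pair z a za
  exact hxy (hG.eq_of_common hzd zd zx.symm (key x zx hxa xa) zy.symm (key y zy hya ya))

/-- The vertices off the pentagon whose only neighbour on it is `a`. -/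
structure Attached (G : SimpleGraph V) (a b c d e z : V) : Prop where
  adj : G.Adj z a
  ne_b : z ≠ b
  ne_c : z ≠ c
  ne_d : z ≠ d
  ne_e : z ≠ e
  not_adj_b : ¬ G.Adj z b
  not_adj_c : ¬ G.Adj z c
  not_adj_d : ¬ G.Adj z d
  not_adj_e : ¬ G.Adj z e

theorem IsPentagon.attached (h : G.IsPentagon a b c d e) (hG : G.IsCritical) {z : V}
    (za : G.Adj z a) (hzb : z ≠ b) (hze : z ≠ e) : G.Attached a b c d e z where
  adj := za
  ne_b := hzb
  ne_c := by rintro rfl; exact h.ac za.symm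
  ne_d := by rintro rfl; exact h.da za
  ne_e := hze
  not_adj_b := h.not_adj_next hG za hzb hze
  not_adj_c := (h.not_adj hG.toIsSparse za hzb hze).1
  not_adj_d := (h.not_adj hG.toIsSparse za hzb hze).2.1
  not_adj_e := h.reflect.not_adj_next hG za hze hzb

/-- The two neighbours of z outside N[a] cannot see b or e without closing a C₄, and c and d each
take at most one of them. -/
theorem IsPentagon.exists_opposite (h : G.IsPentagon a b c d e) (hG : G.IsCritical) {z : V}
    (hz : G.Attached a b c d e z) : ∃ x y, G.Adj z x ∧ G.Adj z y ∧
      G.Attached c d e a b x ∧ G.Attached d e a b c y := by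
  obtain ⟨x, y, hxy, zx, zy, hxa, hya, xa, ya⟩ := hG.exists_pair z a hz.adj
  have key : ∀ x, G.Adj z x → x ≠ a → ¬ G.Adj x a → G.Adj x c ∨ G.Adj x d := by
    intro x zx hxa xa
    rcases h.reached hG x with t | t | t | t | t
    · exact (xa t).elim
    · exact (hG.not_adj_of_path zx.symm hz.adj h.ab xa hxa hz.ne_b t).elim
    · exact .inl t
    · exact .inr t
    · exact (hG.not_adj_of_path zx.symm hz.adj h.ea.symm xa hxa hz.ne_e t).elim
  have ne : ∀ x v, G.Adj z x → ¬ G.Adj z v → x ≠ v := by rintro x v zx zv rfl; exact zv zx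
  have atc : ∀ x, G.Adj z x → G.Adj x c → G.Attached c d e a b x := fun x zx t =>
    h.rotate.rotate.attached hG t (ne x d zx hz.not_adj_d) (ne x b zx hz.not_adj_b)
  have atd : ∀ x, G.Adj z x → G.Adj x d → G.Attached d e a b c x := fun x zx t =>
    h.rotate.rotate.rotate.attached hG t (ne x e zx hz.not_adj_e) (ne x c zx hz.not_adj_c)
  rcases key x zx hxa xa with t | t <;> rcases key y zy hya ya with u | u
  · exact (hxy (hG.eq_of_common hz.ne_c hz.not_adj_c zx.symm t zy.symm u)).elim
  · exact ⟨x, y, zx, zy, atc x zx t, atd y zy u⟩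
  · exact ⟨y, x, zy, zx, atc y zy u, atd x zx t⟩
  · exact (hxy (hG.eq_of_common hz.ne_d hz.not_adj_d zx.symm t zy.symm u)).elim

/-- A fourth neighbour of z finds c and d already taken and is barred from b and e, so it sees a. -/
theorem IsPentagon.exists_partner (h : G.IsPentagon a b c d e) (hG : G.IsCritical)
    (h4 : ∀ v p q r, ∃ z, G.Adj v z ∧ z ≠ p ∧ z ≠ q ∧ z ≠ r) {z : V}
    (hz : G.Attached a b c d e z) : ∃ w, G.Adj z w ∧ G.Attached a b c d e w := by
  obtain ⟨x, y, zx, zy, hx, hy⟩ := h.exists_opposite hG hz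
  obtain ⟨w, zw, hwa, hwx, hwy⟩ := h4 z a x y
  have ne : ∀ v, ¬ G.Adj z v → w ≠ v := by rintro v zv rfl; exact zv zw
  refine ⟨w, zw, h.attached hG ?_ (ne b hz.not_adj_b) (ne e hz.not_adj_e)⟩
  by_contra wa
  rcases h.reached hG w with t | t | t | t | t
  · exact wa t
  · exact hG.not_adj_of_path zw.symm hz.adj h.ab wa hwa hz.ne_b t
  · exact hwx (hG.eq_of_common hz.ne_c hz.not_adj_c zw.symm t zx.symm hx.adj)
  · exact hwy (hG.eq_of_common hz.ne_d hz.not_adj_d zw.symm t zy.symm hy.adj)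
  · exact hG.not_adj_of_path zw.symm hz.adj h.ea.symm wa hwa hz.ne_e t

theorem IsPentagon.exists_attached (h : G.IsPentagon a b c d e) (hG : G.IsCritical) :
    ∃ z, G.Attached a b c d e z := by
  obtain ⟨z, az, hzb, hze⟩ := hG.exists_third a b e
  exact ⟨z, h.attached hG az.symm hzb hze⟩

/-- The induced path s q p r t f g zigzags between the classes at a and c: qp and fg are edges in
the class at a, rt one in the class at c, and s lies at c. -/
theorem IsPentagon.false_of_exists_fourth (h : G.IsPentagon a b c d e) (hG : G.IsCritical)
    (h4 : ∀ v p q r, ∃ z, G.Adj v z ∧ z ≠ p ∧ z ≠ q ∧ z ≠ r) : False := by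
  obtain ⟨p, hp⟩ := h.exists_attached hG
  obtain ⟨q, pq, hq⟩ := h.exists_partner hG h4 hp
  obtain ⟨r, -, pr, -, hr, -⟩ := h.exists_opposite hG hp
  obtain ⟨s, -, qs, -, hs, -⟩ := h.exists_opposite hG hq
  obtain ⟨t, rt, ht⟩ := h.rotate.rotate.exists_partner hG h4 hr
  obtain ⟨-, f, -, tf, -, hf⟩ := h.rotate.rotate.exists_opposite hG ht
  have hf := h.attached hG hf.adj hf.ne_b hf.ne_e
  obtain ⟨g, fg, hg⟩ := h.exists_partner hG h4 hf
  have ua : ∀ {x y w}, G.Attached a b c d e x → G.Attached a b c d e y →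
      G.Attached c d e a b w → G.Adj x w → G.Adj y w → x = y := fun hx hy hw xw yw =>
    hG.eq_of_common hw.ne_d.symm (fun k => hw.not_adj_d k.symm) hx.adj xw hy.adj yw
  have uc : ∀ {x y w}, G.Attached c d e a b x → G.Attached c d e a b y →
      G.Attached a b c d e w → G.Adj w x → G.Adj w y → x = y := fun hx hy hw xw yw =>
    hG.eq_of_common hw.ne_c.symm (fun k => hw.not_adj_c k.symm) hx.adj xw.symm hy.adj yw.symm
  have ta : ∀ {x y z}, G.Attached a b c d e x → G.Attached a b c d e y → G.Adj x z → G.Adj y z →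
      z ≠ a → x ≠ y → G.Adj x y := fun hx hy xz yz hz hxy =>
    hG.quad a _ _ _ hx.adj.symm hy.adj.symm xz.symm yz.symm hz.symm hxy
  have rs : r ≠ s := by rintro rfl; exact pq.ne (ua hp hq hr pr qs)
  have nsp : ¬ G.Adj s p := fun k => rs (uc hr hs hp pr k.symm)
  have hsp : s ≠ p := by rintro rfl; exact hp.not_adj_c hs.adj
  have nqr : ¬ G.Adj q r := fun k => pq.ne (ua hp hq hr pr k)
  have hqr : q ≠ r := by rintro rfl; exact hq.not_adj_c hr.adj
  have nsr : ¬ G.Adj s r := hG.not_adj_of_path qs.symm pq.symm pr nsp hsp hqr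
  have hts : t ≠ s := by rintro rfl; exact nsr rt.symm
  have nst : ¬ G.Adj s t := fun k => ht.adj.ne
    (hG.eq_of_common rs (fun k => nsr k.symm) rt.symm k.symm hr.adj.symm hs.adj.symm)
  have nqt : ¬ G.Adj q t := fun k => hts (uc ht hs hq k qs)
  have npt : ¬ G.Adj p t := fun k => rt.ne (uc hr ht hp pr k)
  have hfq : f ≠ q := by rintro rfl; exact nqt tf.symm
  have hfp : f ≠ p := by rintro rfl; exact npt tf.symm
  have nsf : ¬ G.Adj s f := fun k => hfq (ua hf hq hs k.symm qs)
  have nrf : ¬ G.Adj r f := fun k => hfp (ua hf hp hr k.symm pr)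
  have hrf : r ≠ f := by rintro rfl; exact hf.not_adj_c hr.adj
  have htp : t ≠ p := by rintro rfl; exact hp.not_adj_c ht.adj
  have npf : ¬ G.Adj p f := fun k =>
    hG.not_adj_of_path tf.symm rt.symm pr.symm (fun k => nrf k.symm) hrf.symm htp k.symm
  have nqf : ¬ G.Adj q f := fun k => npf (ta hp hf pq k.symm hq.adj.ne hfp.symm)
  have hgp : g ≠ p := by rintro rfl; exact npf fg.symm
  have hgq : g ≠ q := by rintro rfl; exact nqf fg.symm
  have nsg : ¬ G.Adj s g := fun k => hgq (ua hg hq hs k.symm qs)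
  have npg : ¬ G.Adj p g := fun k => npf (ta hp hf k fg hg.adj.ne hfp.symm)
  have nqg : ¬ G.Adj q g := fun k => npg (ta hp hg pq k.symm hq.adj.ne hgp.symm)
  have nrg : ¬ G.Adj r g := fun k => hgp (ua hg hp hr k.symm pr)
  have ntg : ¬ G.Adj t g := fun k => fg.ne (ua hf hg ht tf.symm k.symm)
  exact hG.path s q p r t f g qs.symm pq.symm pr rt tf fg nsp nsr nst nsf nsg nqr nqt nqf nqg
    npt npf npg nrf nrg ntg

theorem IsPentagon.eq_or_attached (h : G.IsPentagon a b c d e) (hG : G.IsCritical) (x : V) :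
    (x = a ∨ x = b ∨ x = c ∨ x = d ∨ x = e) ∨ G.Attached a b c d e x ∨ G.Attached b c d e a x ∨
      G.Attached c d e a b x ∨ G.Attached d e a b c x ∨ G.Attached e a b c d x := by
  by_contra! hn
  obtain ⟨⟨ha, hb, hc, hd, he⟩, h1, h2, h3, h4, h5⟩ := hn
  rcases h.reached hG x with t | t | t | t | t
  · exact h1 (h.attached hG t hb he)
  · exact h2 (h.rotate.attached hG t hc ha)
  · exact h3 (h.rotate.rotate.attached hG t hd hb)
  · exact h4 (h.rotate.rotate.rotate.attached hG t he hc)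
  · exact h5 (h.rotate.rotate.rotate.rotate.attached hG t ha hd)

theorem IsPentagon.not_adj_of_attached (h : G.IsPentagon a b c d e) (hG : G.IsCritical) {x y : V}
    (hx : G.Attached a b c d e x) (hy : G.Attached b c d e a y) : ¬ G.Adj x y :=
  hG.not_adj_of_path hx.adj h.ab hy.adj.symm hx.not_adj_b hx.ne_b hy.ne_e.symm

/-- Each class is independent by triangle-freeness, and classes at consecutive pentagon vertices
have no edges between them. So the classes at e, a share a colour, as do those at c, d, and the
class at b has its own; pentagon vertices fit in around them. -/
theorem IsPentagon.colorable_three (h : G.IsPentagon a b c d e) (hG : G.IsCritical)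
    (h3 : ∀ x y z, G.Adj x y → G.Adj y z → ¬ G.Adj x z) : G.Colorable 3 := by
  classical
  have hA : ∀ v x y, G.Adj x v → G.Adj y v → ¬ G.Adj x y := fun v x y hx hy => h3 x v y hx hy.symm
  have hcd := fun x y => h.rotate.rotate.not_adj_of_attached hG (x := x) (y := y)
  have hea := fun x y => h.rotate.rotate.rotate.rotate.not_adj_of_attached hG (x := x) (y := y)
  let P : V → Prop := fun x => x = a ∨ x = c ∨ G.Attached b c d e a x
  let Q : V → Prop := fun x => x = b ∨ x = d ∨ G.Attached a b c d e x ∨ G.Attached e a b c d x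
  let R : V → Prop := fun x => x = e ∨ G.Attached c d e a b x ∨ G.Attached d e a b c x
  have hP : ∀ x y, P x → P y → ¬ G.Adj x y := by
    rintro x y (rfl | rfl | hx) (rfl | rfl | hy) t
    · exact t.ne rfl
    · exact h.ac t
    · exact hy.not_adj_e t.symm
    · exact h.ac t.symm
    · exact t.ne rfl
    · exact hy.not_adj_b t.symm
    · exact hx.not_adj_e t
    · exact hx.not_adj_b t
    · exact hA b x y hx.adj hy.adj t
  have hQ : ∀ x y, Q x → Q y → ¬ G.Adj x y := by
    rintro x y (rfl | rfl | hx | hx) (rfl | rfl | hy | hy) t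
    · exact t.ne rfl
    · exact h.bd t
    · exact hy.not_adj_b t.symm
    · exact hy.not_adj_c t.symm
    · exact h.bd t.symm
    · exact t.ne rfl
    · exact hy.not_adj_d t.symm
    · exact hy.not_adj_e t.symm
    · exact hx.not_adj_b t
    · exact hx.not_adj_d t
    · exact hA a x y hx.adj hy.adj t
    · exact hea y x hy hx t.symm
    · exact hx.not_adj_c t
    · exact hx.not_adj_e t
    · exact hea x y hx hy t
    · exact hA e x y hx.adj hy.adj t
  have hR : ∀ x y, R x → R y → ¬ G.Adj x y := by
    rintro x y (rfl | hx | hx) (rfl | hy | hy) t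
    · exact t.ne rfl
    · exact hy.not_adj_c t.symm
    · exact hy.not_adj_b t.symm
    · exact hx.not_adj_c t
    · exact hA c x y hx.adj hy.adj t
    · exact hcd x y hx hy t
    · exact hx.not_adj_b t
    · exact hcd y x hy hx t.symm
    · exact hA d x y hx.adj hy.adj t
  have hcover : ∀ x, ¬ P x → ¬ Q x → R x := by
    intro x
    have := h.eq_or_attached hG x
    simp only [P, Q, R]
    tauto
  refine ⟨Coloring.mk (fun x => if P x then (0 : Fin 3) else if Q x then 1 else 2) ?_⟩
  intro x y t
  by_cases h1 : P x <;> by_cases h2 : P y <;> by_cases h3 : Q x <;> by_cases h4 : Q y <;>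
    simp only [h1, h2, h3, h4, if_true, if_false, ne_eq, Fin.reduceEq, not_false_eq_true,
      not_true_eq_false]
  all_goals first
    | exact hP x y h1 h2 t
    | exact hQ x y h3 h4 t
    | exact hR x y (hcover x h1 h3) (hcover y h2 h4) t

theorem IsCritical.colorable_three (hG : G.IsCritical) : G.Colorable 3 := by
  by_cases h5 : G.PentagonFree
  · by_cases hV : Nonempty V
    · obtain ⟨a⟩ := hV
      obtain ⟨b, hab, -⟩ := hG.exists_third a a a
      exact (hG.false_of_hexagonFree h5 (hG.not_isHexagon h5) a b hab).elim
    · rw [not_nonempty_iff] at hV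
      exact .of_isEmpty 3
  · simp only [PentagonFree, not_forall, not_not] at h5
    obtain ⟨a, b, c, d, e, h⟩ := h5
    rcases hG.exists_fourth_or with h4 | h3
    · exact (h.false_of_exists_fourth hG h4).elim
    · exact h.colorable_three hG h3

end SimpleGraph

/-! ### Reduction to critical graphs by induction. -/

namespace SimpleGraph

universe u

variable {V : Type u} {G : SimpleGraph V}

theorem colorable_of_induce_compl_singleton [Fintype V] [DecidableRel G.Adj] {k : ℕ} {v : V}
    (hv : G.degree v < k) (h : (G.induce {v}ᶜ).Colorable k) : G.Colorable k := by
  classical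
  obtain ⟨C⟩ := h
  let f : V → Option (Fin k) := fun x => if hx : x ∈ ({v}ᶜ : Set V) then some (C ⟨x, hx⟩) else none
  have hf : ∀ x (hx : x ≠ v), f x = some (C ⟨x, hx⟩) := fun x hx => dif_pos hx
  obtain ⟨i, hi⟩ : ∃ i : Fin k, some i ∉ (G.neighborFinset v).image f := by
    by_contra! hn
    have h1 := Finset.card_le_card (s := Finset.univ.map Function.Embedding.some)
      (t := (G.neighborFinset v).image f) (by
        intro x hx
        simp only [Finset.mem_map, Finset.mem_univ, true_and] at hx
        obtain ⟨i, rfl⟩ := hx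
        exact hn i)
    have h2 := Finset.card_image_le (s := G.neighborFinset v) (f := f)
    simp only [Finset.card_map, Finset.card_univ, Fintype.card_fin, card_neighborFinset_eq_degree]
      at h1 h2
    lia
  have hi' : ∀ x (hx : x ≠ v), G.Adj v x → C ⟨x, hx⟩ ≠ i := fun x hx t e =>
    hi (Finset.mem_image.2 ⟨x, by simpa using t, by rw [hf x hx, e]⟩)
  -- `f` is `none` only at `v`, so the default `i` is the colour of `v`, one missing on its
  -- neighbours.
  refine ⟨Coloring.mk (fun x => (f x).getD i) ?_⟩
  intro x y t
  by_cases hx : x = v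
  · have hy : y ≠ v := hx ▸ t.ne'
    have hfx : f x = none := by simp [f, hx]
    rw [hfx, hf y hy]
    exact (hi' y hy (hx ▸ t)).symm
  · by_cases hy : y = v
    · have hfy : f y = none := by simp [f, hy]
      rw [hfy, hf x hx]
      exact hi' x hx (hy ▸ t.symm)
    · rw [hf x hx, hf y hy]
      exact C.valid (v := ⟨x, hx⟩) (w := ⟨y, hy⟩) t

theorem colorable_of_induce_of_induce_compl {k : ℕ} {s : Set V}
    (hs : ∀ x ∈ s, ∀ y, G.Adj x y → y ∈ s) (h1 : (G.induce s).Colorable k)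
    (h2 : (G.induce sᶜ).Colorable k) : G.Colorable k := by
  classical
  obtain ⟨C⟩ := h1
  obtain ⟨D⟩ := h2
  refine ⟨Coloring.mk (fun x => if hx : x ∈ s then C ⟨x, hx⟩ else D ⟨x, hx⟩) ?_⟩
  intro x y t
  by_cases hx : x ∈ s
  · have hy := hs x hx y t
    simp only [hx, hy, dif_pos]
    exact C.valid (v := ⟨x, hx⟩) (w := ⟨y, hy⟩) t
  · have hy : y ∉ s := fun hy => hx (hs y hy x t.symm)
    simp only [hx, hy, dif_neg, not_false_eq_true]
    exact D.valid (v := ⟨x, hx⟩) (w := ⟨y, hy⟩) t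

theorem exists_adj_notMem_of_card_lt_degree [Fintype V] [DecidableRel G.Adj] {v : V}
    (s : Finset V) (h : s.card < G.degree v) : ∃ z, G.Adj v z ∧ z ∉ s := by
  obtain ⟨z, hz, hzs⟩ := Finset.exists_mem_notMem_of_card_lt_card
    (by rwa [card_neighborFinset_eq_degree] : s.card < (G.neighborFinset v).card)
  exact ⟨z, by simpa using hz, hzs⟩

/-- At most `k - 2` neighbours of `v` lie in the clique on the edge `v u` and its common neighbours,
so at least two lie outside it. -/
theorem IsSparse.one_lt_card_filter [Fintype V] [DecidableEq V] [DecidableRel G.Adj]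
    (hG : G.IsSparse) {k : ℕ} (hk : G.CliqueFree k) {v u : V} (hvu : G.Adj v u)
    (hd : k ≤ G.degree v) :
    1 < ((G.neighborFinset v).filter fun x => x ≠ u ∧ ¬ G.Adj x u).card := by
  have hc : G.IsClique
      ((insert v (insert u ((G.neighborFinset v).filter (G.Adj u))) : Finset V) : Set V) := by
    simp only [Finset.coe_insert, Finset.coe_filter, mem_neighborFinset]
    refine IsClique.insert (IsClique.insert ?_ ?_) ?_
    · intro x hx y hy hxy
      exact hG.quad v u x y hx.1 hy.1 hx.2 hy.2 hvu.ne hxy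
    · intro x hx _
      exact hx.2
    · rintro x (rfl | hx) _
      · exact hvu
      · exact hx.1
  have hlt : (insert v (insert u ((G.neighborFinset v).filter (G.Adj u)))).card < k := by
    by_contra! hle
    exact hk.mono hle _ ⟨hc, rfl⟩
  have hv : v ∉ insert u ((G.neighborFinset v).filter (G.Adj u)) := by simp [hvu.ne]
  have hu : u ∉ (G.neighborFinset v).filter (G.Adj u) := by simp
  rw [Finset.card_insert_of_notMem hv, Finset.card_insert_of_notMem hu] at hlt
  have hsub : G.neighborFinset v ⊆ insert u ((G.neighborFinset v).filter (G.Adj u)) ∪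
      (G.neighborFinset v).filter fun x => x ≠ u ∧ ¬ G.Adj x u := by
    intro x hx
    simp only [Finset.mem_union, Finset.mem_insert, Finset.mem_filter, G.adj_comm u x]
    tauto
  have h1 := (Finset.card_le_card hsub).trans (Finset.card_union_le _ _)
  rw [Finset.card_insert_of_notMem hu, card_neighborFinset_eq_degree] at h1
  lia

theorem IsSparse.isCritical [Fintype V] [DecidableRel G.Adj] (hG : G.IsSparse) {k : ℕ}
    (hk3 : 3 ≤ k) (hk : G.CliqueFree k) (hd : ∀ v, k ≤ G.degree v)
    (hc : ∀ s : Set V, s.Nonempty → (∀ x ∈ s, ∀ y, G.Adj x y → y ∈ s) → ∀ x, x ∈ s) :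
    G.IsCritical where
  toIsSparse := hG
  exists_third v p q := by
    classical
    obtain ⟨z, hz, hzs⟩ := exists_adj_notMem_of_card_lt_degree (G := G) (v := v) {p, q}
      ((Finset.card_le_two).trans_lt (by have := hd v; lia))
    exact ⟨z, hz, by simpa using hzs⟩
  exists_pair v u hvu := by
    classical
    obtain ⟨x, hx, y, hy, hxy⟩ := Finset.one_lt_card.1 (hG.one_lt_card_filter hk hvu (hd v))
    simp only [Finset.mem_filter, mem_neighborFinset] at hx hy
    exact ⟨x, y, hxy, hx.1, hy.1, hx.2.1, hy.2.1, hx.2.2, hy.2.2⟩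
  exists_fourth_or := by
    classical
    -- For k = 3, being `CliqueFree 3` is triangle-freeness; for k ≥ 4 the minimum degree is at
    -- least four.
    rcases hk3.eq_or_lt with rfl | hk4
    · refine .inr fun x y z hxy hyz hxz => hk {x, y, z} ?_
      exact is3Clique_triple_iff.2 ⟨hxy, hxz, hyz⟩
    · refine .inl fun v p q r => ?_
      obtain ⟨z, hz, hzs⟩ := exists_adj_notMem_of_card_lt_degree (G := G) (v := v) {p, q, r}
        ((Finset.card_le_three).trans_lt (by have := hd v; lia))
      exact ⟨z, hz, by simpa using hzs⟩
  mem_of_closed := hc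

theorem IsSparse.colorable {k : ℕ} (hk3 : 3 ≤ k) (n : ℕ) :
    ∀ {V : Type u} [Finite V] {G : SimpleGraph V}, Nat.card V = n → G.IsSparse → G.CliqueFree k →
      G.Colorable k := by
  classical
  induction n using Nat.strong_induction_on with
  | _ n ih =>
  intro V _ G hn hG hk
  have := Fintype.ofFinite V
  have hind : ∀ s : Set V, s ≠ Set.univ → (G.induce s).Colorable k := by
    intro s hs
    refine ih (Nat.card s) ?_ rfl (hG.induce s) (hk.comap ⟨(Embedding.induce s).toCopy⟩)
    rw [← hn, Nat.card_coe_set_eq, ← Set.ncard_univ]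
    exact Set.ncard_lt_ncard (Set.ssubset_univ_iff.2 hs) Set.finite_univ
  by_cases hd : ∀ v, k ≤ G.degree v
  · by_cases hc : ∀ s : Set V, s.Nonempty → (∀ x ∈ s, ∀ y, G.Adj x y → y ∈ s) → ∀ x, x ∈ s
    · exact (hG.isCritical hk3 hk hd hc).colorable_three.mono hk3
    · push Not at hc
      obtain ⟨s, hs, hcl, x, hx⟩ := hc
      refine colorable_of_induce_of_induce_compl hcl (hind s ?_) (hind sᶜ ?_)
      · rintro rfl; exact hx trivial
      · simpa using hs.ne_empty
  · push Not at hd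
    obtain ⟨v, hv⟩ := hd
    exact colorable_of_induce_compl_singleton hv (hind _ (by simp))

end SimpleGraph

theorem mainTheorem5 {V : Type*} [Finite V] (G : SimpleGraph V)
    (hP7 : IsInducedFree (SimpleGraph.pathGraph 7) G)
    (hC7 : IsInducedFree (SimpleGraph.cycleGraph 7) G)
    (hC4 : IsInducedFree (SimpleGraph.cycleGraph 4) G)
    (hDiamond : IsInducedFree diamondGraph G) :
    G.chromaticNumber ≤ (G.cliqueNum : ℕ∞) + 1 := by
  have := Fintype.ofFinite V
  have hG := SimpleGraph.isSparse_of_free hP7 hC7 hC4 hDiamond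
  suffices h : G.Colorable (G.cliqueNum + 1) by exact_mod_cast h.chromaticNumber_le
  have hfree : G.CliqueFree (G.cliqueNum + 1) := fun s hs => by
    have := hs.isClique.card_le_cliqueNum
    have := hs.card_eq
    lia
  by_cases hE : ∃ a b, G.Adj a b
  · obtain ⟨a, b, hab⟩ := hE
    -- The edge gives ω ≥ 2, which is what 3 ≤ ω + 1 requires.
    refine hG.colorable ?_ _ rfl hfree
    classical
    have h2 : G.IsClique ({a, b} : Finset V) := by
      simpa [SimpleGraph.isClique_pair] using fun _ => hab
    have := h2.card_le_cliqueNum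
    rw [Finset.card_pair hab.ne] at this
    lia
  · push Not at hE
    exact ⟨SimpleGraph.Coloring.mk (fun _ => 0) fun {x y} t => (hE x y t).elim⟩
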